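/- Let $\mathcal A$ be a locally noetherian Grothendieck category, i.e. a Grothendieck category with a small generating family of noetherian objects. Subcategories are full. A Serre subcategory is one containing $0$ and closed under subobjects, quotients and extensions; a localizing subcategory is a Serre subcategory closed under arbitrary direct sums. A nullity class is a full subcategory closed under quotients and extensions. For an object $M$, let $\sqrt M$ be the smallest Serre subcategory and $\overline{C(M)}$ the smallest nullity class containing $M$. A nonzero object $M$ is premonoform if no nonzero quotient $M/N$ with $N\neq 0$ is isomorphic to a subobject of $M$. Call premonoform objects $H,G$ equivalent if $\overline{C(H)}=\overline{C(G)}$; let $\mathrm{PSpec}\,\mathcal A$ be the collection of equivalence classes $[H]$ of premonoform objects, and $\mathrm{nPSpec}\,\mathcal A$ the collection of the classes that are represented by a noetherian premonoform object. For an object $M$ put $$\mathrm{sPSupp}\,M=\{[H]\in\mathrm{PSpec}\,\mathcal A : H\in\sqrt M\},\qquad \mathrm{nsPSupp}\,M=\mathrm{sPSupp}\,M\cap\mathrm{nPSpec}\,\mathcal A ;$$ for a subcategory $\mathcal X$ put $\mathrm{nsPSupp}\,\mathcal X=\bigcup_{M\in\mathcal X}\mathrm{nsPSupp}\,M$, and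 for $\Phi\subseteq\mathrm{nPSpec}\,\mathcal A$ put $\mathrm{nsPSupp}^{-1}\Phi=\{M\in\mathcal A : \mathrm{nsPSupp}\,M\subseteq\Phi\}$. A subset $\Phi\subseteq\mathrm{nPSpec}\,\mathcal A$ is Serre closed if $\mathrm{sPSupp}\,H\subseteq\Phi$ for every $[H]\in\Phi$, and Serre extension-closed if for every exact sequence $0\to M\to X\to N\to 0$ in $\mathcal A$ with $\mathrm{nsPSupp}\,M,\ \mathrm{nsPSupp}\,N\subseteq\Phi$ one has $\mathrm{nsPSupp}\,X\subseteq\Phi$. Theorem. The map $\mathcal X\mapsto\mathrm{nsPSupp}\,\mathcal X$ is a bijection from the localizing subcategories of $\mathcal A$ onto the subsets of $\mathrm{nPSpec}\,\mathcal A$ that are both Serre closed and Serre extension-closed. Its inverse is the map $\Phi\mapsto\mathrm{nsPSupp}^{-1}\Phi$. -/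

import Mathlib

open CategoryTheory CategoryTheory.Limits

universe w v u

namespace PremonoformSpectrum

variable {C : Type u} [Category.{v} C] [Abelian C]

/-- `C` has a (small) generating family of noetherian objects. Together with
`IsGrothendieckAbelian.{w} C` this says that `C` is a locally noetherian Grothendieck category. -/
def IsLocallyNoetherian (C : Type u) [Category.{v} C] : Prop :=
  ∃ (ι : Type w) (G : ι → C),
    (∀ i, IsNoetherianObject (G i)) ∧ (ObjectProperty.ofObj G).IsSeparating

/-- Full subcategories are predicates on objects. A localizing subcategory is a Serre subcategory
(it contains zero and is closed under subobjects, quotients and extensions) which is closed under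
arbitrary direct sums. -/
def IsLocalizing (X : ObjectProperty C) : Prop :=
  X.IsSerreClass ∧ ∀ J : Type w, X.IsClosedUnderColimitsOfShape (Discrete J)

/-- The smallest Serre subcategory containing `X`, written `√X`. -/
def serreClosure (X : ObjectProperty C) : ObjectProperty C :=
  fun Y ↦ ∀ S : ObjectProperty C, S.IsSerreClass → X ≤ S → S Y

/-- A nullity class: a full subcategory closed under quotients and extensions. -/
def IsNullityClass (X : ObjectProperty C) : Prop :=
  X.IsClosedUnderQuotients ∧ X.IsClosedUnderExtensions

/-- The smallest nullity class containing the object `M`. -/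
def nullityClosure (M : C) : ObjectProperty C :=
  fun Y ↦ ∀ N : ObjectProperty C, IsNullityClass N → N M → N Y

/-- A nonzero object `M` is premonoform if no nontrivial quotient of `M` (a nonzero quotient by a
nonzero subobject) is isomorphic to a subobject of `M`. -/
def IsPremonoform (M : C) : Prop :=
  ¬ IsZero M ∧ ∀ ⦃Q : C⦄ (p : M ⟶ Q) (i : Q ⟶ M), Epi p → Mono i → IsZero Q ∨ IsIso p

variable (C) in
/-- The premonoform objects of `C`. -/
abbrev Premonoform : Type u := {M : C // IsPremonoform M}

variable (C) in
/-- Two premonoform objects are equivalent if they generate the same nullity class. In particular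
isomorphic objects are equivalent, so that it does not matter whether one starts from objects or
from isomorphism classes. -/
instance premonoformSetoid : Setoid (Premonoform C) where
  r H G := nullityClosure H.1 = nullityClosure G.1
  iseqv := ⟨fun _ ↦ rfl, Eq.symm, Eq.trans⟩

variable (C) in
/-- The premonoform spectrum of `C`. -/
def PSpec : Type u := Quotient (premonoformSetoid C)

/-- The class `[H]` of a premonoform object `H`. -/
def PSpec.mk (H : Premonoform C) : PSpec C := Quotient.mk _ H

variable (C) in
/-- The classes represented by noetherian premonoform objects. -/
def nPSpec : Set (PSpec C) :=
  {p | ∃ H : Premonoform C, PSpec.mk H = p ∧ IsNoetherianObject H.1}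

/-- The Serre psupport of an object: the classes `[H]` with `H ∈ √M`. -/
def sPSupp (M : C) : Set (PSpec C) :=
  {p | ∃ H : Premonoform C, PSpec.mk H = p ∧ serreClosure (ObjectProperty.singleton M) H.1}

/-- The noetherian Serre psupport of an object. -/
def nsPSupp (M : C) : Set (PSpec C) := sPSupp M ∩ nPSpec C

/-- The noetherian Serre psupport of a full subcategory. -/
def nsPSuppOf (X : ObjectProperty C) : Set (PSpec C) :=
  (⋃ (M : C) (_ : X M), sPSupp M) ∩ nPSpec C

/-- The full subcategory of the objects `M` whose noetherian Serre psupport is contained in `Φ`. -/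
def nsPSuppInv (Φ : Set (PSpec C)) : ObjectProperty C := fun M ↦ nsPSupp M ⊆ Φ

/-- `Φ` contains `sPSupp H` whenever it contains `[H]`. -/
def IsSerreClosed (Φ : Set (PSpec C)) : Prop :=
  ∀ H : Premonoform C, PSpec.mk H ∈ Φ → sPSupp H.1 ⊆ Φ

/-- A subset `Φ` of `nPSpec C` is Serre extension-closed (relative to `nPSpec C`) if for every
exact sequence `0 ⟶ M ⟶ X ⟶ N ⟶ 0` the condition `nsPSupp M, nsPSupp N ⊆ Φ` implies
`nsPSupp X ⊆ Φ`. -/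
def IsSerreExtensionClosed (Φ : Set (PSpec C)) : Prop :=
  ∀ S : ShortComplex C, S.ShortExact →
    nsPSupp S.X₁ ⊆ Φ → nsPSupp S.X₃ ⊆ Φ → nsPSupp S.X₂ ⊆ Φ

/-- Membership in the Serre psupport does not depend on the representative. -/
theorem mk_mem_sPSupp_iff (H : Premonoform C) (M : C) :
    PSpec.mk H ∈ sPSupp M ↔ serreClosure (ObjectProperty.singleton M) H.1 := by
  refine ⟨?_, fun h ↦ ⟨H, rfl, h⟩⟩
  rintro ⟨G, hG, h⟩ S hS hM
  have e : nullityClosure G.1 = nullityClosure H.1 := Quotient.exact hG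
  have hH : nullityClosure G.1 H.1 := by
    rw [e]; exact fun _ _ h ↦ h
  exact hH S ⟨inferInstance, inferInstance⟩ (h S hS hM)

end PremonoformSpectrum

/-! Two reductions recover a localizing subcategory from its support. In a locally noetherian
category an object is a quotient of a coproduct of its noetherian subobjects, so only noetherian
objects matter (`prop_of_noetherianLocally`). And a noetherian object lies in a Serre subcategory
`S` once its premonoform quotients do (`prop_of_premonoform_quotients`): a quotient `Q` outside `S`
with maximal kernel has all proper quotients in `S`; were it not premonoform, some nonzero proper
quotient `Q'` would embed in `Q`, making `Q` an extension of two proper quotients.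

Conversely, Serre closedness puts `H` in `nsPSuppInv Φ` for each `[H] ∈ Φ`, which recovers `Φ`, and
extension-closedness makes `nsPSuppInv Φ` a Serre subcategory. Closure under coproducts is the hard
point. The objects whose noetherian subobjects lie in a Serre subcategory again form a Serre
subcategory (`isSerreClass_noetherianLocally`), and it contains the coproducts of objects of the
original one (`noetherianLocally_of_isColimit`), because a noetherian subobject of a coproduct meets
only finitely many summands. -/

namespace PremonoformSpectrum

open ZeroObject

variable {C : Type u} [Category.{v} C] [Abelian C]

/-! ### Noetherian objects and their premonoform quotients -/

section Noetherian

/-- If `π` is epi and the kernel of `π ≫ p` is contained in that of `π`, then `p` is mono. -/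
theorem mono_of_kernelSubobject_comp_le {M Q Q' : C} (π : M ⟶ Q) [Epi π] (p : Q ⟶ Q')
    (h : kernelSubobject (π ≫ p) ≤ kernelSubobject π) : Mono p := by
  refine Preadditive.mono_of_cancel_zero _ fun z hz ↦ ?_
  obtain ⟨T, e, _, y, hy⟩ := surjective_up_to_refinements_of_epi π z
  have h1 : (kernelSubobject (π ≫ p)).Factors y :=
    kernelSubobject_factors _ _ (by rw [← Category.assoc, ← hy, Category.assoc, hz, comp_zero])
  have h2 := (kernelSubobject_factors_iff _ _).1 (Subobject.factors_of_le y h h1)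
  rw [← cancel_epi e, hy, h2, comp_zero]

/-- Inclusion of subobjects may be checked after precomposition with an epimorphism. -/
theorem subobject_le_of_factors_epi_comp {X T : C} {A B : Subobject X} (e : T ⟶ (A : C)) [Epi e]
    (h : B.Factors (e ≫ A.arrow)) : A ≤ B := by
  have h0 : A.arrow ≫ cokernel.π B.arrow = 0 := by
    rw [← cancel_epi e, ← Category.assoc, ← B.factorThru_arrow _ h, Category.assoc,
      cokernel.condition, comp_zero, comp_zero]
  exact Subobject.le_of_comm (Abelian.monoLift B.arrow A.arrow h0)
    (Abelian.monoLift_comp B.arrow A.arrow h0)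

omit [Abelian C] in
theorem isNoetherianObject_of_strictMono {X : C} {α : Type*} [PartialOrder α] [WellFoundedGT α]
    {f : Subobject X → α} (hf : StrictMono f) : IsNoetherianObject X :=
  ⟨hf.wellFoundedGT⟩

/-- Pulling subobjects back along an epimorphism is injective. -/
theorem isNoetherianObject_of_epi {X Y : C} (p : X ⟶ Y) [Epi p] [IsNoetherianObject X] :
    IsNoetherianObject Y := by
  have key : ∀ A B : Subobject Y, (Subobject.pullback p).obj A = (Subobject.pullback p).obj B →
      A ≤ B := by
    intro A B hAB
    obtain ⟨T, e, _, y, hy⟩ := surjective_up_to_refinements_of_epi p A.arrow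
    refine subobject_le_of_factors_epi_comp e ?_
    rw [hy, ← pullback_factors_iff, ← hAB, pullback_factors_iff, ← hy]
    exact (A.factors_iff _).2 ⟨e, rfl⟩
  exact isNoetherianObject_of_strictMono (f := (Subobject.pullback p).obj)
    ((Subobject.pullback p).monotone.strictMono_of_injective fun A B hAB ↦
      le_antisymm (key _ _ hAB) (key _ _ hAB.symm))

/-- By the modular law, nested subobjects of the middle term with the same trace on `S.X₁` and the
same image in `S.X₃` coincide. -/
theorem isNoetherianObject_of_shortExact {S : ShortComplex C} (hS : S.ShortExact)
    [IsNoetherianObject S.X₁] [IsNoetherianObject S.X₃] : IsNoetherianObject S.X₂ := by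
  let F : Subobject S.X₂ → Subobject S.X₁ × Subobject S.X₃ := fun A ↦
    ((Subobject.pullback S.f).obj A, imageSubobject (A.arrow ≫ S.g))
  have hF : Monotone F := fun A B hAB ↦
    ⟨(Subobject.pullback S.f).monotone hAB, by
      have : A.arrow ≫ S.g = Subobject.ofLE A B hAB ≫ B.arrow ≫ S.g := by
        rw [Subobject.ofLE_arrow_assoc]
      dsimp [F]
      rw [this]
      exact imageSubobject_comp_le _ _⟩
  refine isNoetherianObject_of_strictMono (f := F) fun A B hAB ↦
    lt_of_le_of_ne (hF hAB.le) fun heq ↦ hAB.not_ge ?_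
  obtain ⟨h1, h3⟩ := Prod.ext_iff.1 heq
  dsimp only [F] at h1 h3
  -- As the images in `S.X₃` agree, an element of `B` differs, after refinement, from one of `A` by
  -- an element of `S.X₁`; this lies in the trace of `B`, hence in that of `A`.
  let b : (B : C) ⟶ imageSubobject (A.arrow ≫ S.g) :=
    factorThruImageSubobject (B.arrow ≫ S.g) ≫ Subobject.ofLE _ _ h3.ge
  have hb : b ≫ (imageSubobject (A.arrow ≫ S.g)).arrow = B.arrow ≫ S.g := by simp [b]
  obtain ⟨T, e, _, a, ha⟩ :=
    surjective_up_to_refinements_of_epi (factorThruImageSubobject (A.arrow ≫ S.g)) b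
  have ha' : e ≫ B.arrow ≫ S.g = a ≫ A.arrow ≫ S.g := by
    rw [← hb, reassoc_of% ha, imageSubobject_arrow_comp]
  obtain ⟨T', e', _, x, hx⟩ := hS.exact.exact_up_to_refinements (e ≫ B.arrow - a ≫ A.arrow)
    (by simp [ha'])
  have hxB : B.Factors (x ≫ S.f) := by
    rw [← hx]
    refine (B.factors_iff _).2 ⟨e' ≫ (e - a ≫ Subobject.ofLE _ _ hAB.le), ?_⟩
    change (e' ≫ (e - a ≫ Subobject.ofLE _ _ hAB.le)) ≫ B.arrow = _
    simp
  rw [← pullback_factors_iff, ← h1, pullback_factors_iff] at hxB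
  refine subobject_le_of_factors_epi_comp (e' ≫ e) ?_
  have : (e' ≫ e) ≫ B.arrow = x ≫ S.f + (e' ≫ a) ≫ A.arrow := by
    rw [← hx]; simp
  rw [this]
  exact Subobject.factors_add _ _ hxB ((A.factors_iff _).2 ⟨e' ≫ a, rfl⟩)

instance isSerreClass_isNoetherianObject : (isNoetherianObject (C := C)).IsSerreClass where
  prop_of_epi f _ h := by
    have : IsNoetherianObject _ := ⟨h⟩
    exact (isNoetherianObject_of_epi f).prop
  prop_X₂_of_shortExact hS h₁ h₃ := by
    have : IsNoetherianObject _ := ⟨h₁⟩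
    have : IsNoetherianObject _ := ⟨h₃⟩
    exact (isNoetherianObject_of_shortExact hS).prop

/-- A noetherian object belongs to a Serre subcategory as soon as its premonoform quotients do. -/
theorem prop_of_premonoform_quotients (S : ObjectProperty C) [S.IsSerreClass] (M : C)
    [IsNoetherianObject M]
    (h : ∀ (Q : C) (π : M ⟶ Q), Epi π → IsPremonoform Q → S Q) : S M := by
  suffices H : ∀ (N : Subobject M) (Q : C) (π : M ⟶ Q), Epi π → kernelSubobject π = N → S Q from
    H _ M (𝟙 M) inferInstance rfl
  intro N
  induction N using WellFoundedGT.induction with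
  | ind N ih =>
    rintro Q π hπ rfl
    have proper : ∀ (Q' : C) (p : Q ⟶ Q'), Epi p → ¬ IsIso p → S Q' := by
      intro Q' p hp hiso
      refine ih _ (lt_of_le_not_ge (kernelSubobject_comp_le π p) fun hle ↦ hiso ?_) Q' (π ≫ p)
        (epi_comp _ _) rfl
      have := mono_of_kernelSubobject_comp_le π p hle
      exact isIso_of_mono_of_epi p
    by_contra hQ
    refine hQ (h Q π hπ ⟨fun h0 ↦ hQ (S.prop_of_isZero h0), fun Q' p i hp hi ↦ ?_⟩)
    by_contra! hne
    obtain ⟨hQ', hp'⟩ := hne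
    -- `Q'` and `cokernel i` are both proper quotients of `Q`, the second because `i ≠ 0`.
    refine hQ (S.prop_X₂_of_shortExact (S := ShortComplex.mk i (cokernel.π i) (by simp))
      { exact := ShortComplex.exact_cokernel i } (proper Q' p hp hp')
      (proper _ (cokernel.π i) inferInstance fun hiso ↦ hQ' ?_))
    have : i = 0 := by
      rw [← cancel_mono (cokernel.π i), cokernel.condition, zero_comp]
    exact IsZero.of_mono_eq_zero i this

end Noetherian

/-! ### Serre closures and supports -/

section SerreClosure

theorem prop_of_kernel_of_image (S : ObjectProperty C) [S.IsSerreClass] {A B : C} (f : A ⟶ B)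
    (hk : S (kernel f)) (hi : S (image f)) : S A :=
  S.prop_X₂_of_shortExact
    (S := ShortComplex.mk (kernel.ι f) (factorThruImage f)
      (by rw [← cancel_mono (image.ι f)]; simp))
    { exact := by
        refine ShortComplex.exact_of_f_is_kernel _ (KernelFork.IsLimit.ofι _ _
          (fun g hg ↦ kernel.lift f g ?_) (fun g hg ↦ by simp) ?_)
        · rw [← image.fac f, reassoc_of% hg, zero_comp]
        · intro _ g hg m hm
          rw [← cancel_mono (kernel.ι f), kernel.lift_ι]
          exact hm } hk hi

instance isSerreClass_serreClosure (X : ObjectProperty C) : (serreClosure X).IsSerreClass where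
  exists_zero := ⟨0, isZero_zero C, fun S _ _ ↦ S.prop_of_isZero (isZero_zero C)⟩
  prop_of_mono f _ h S hS hX := S.prop_of_mono f (h S hS hX)
  prop_of_epi f _ h S hS hX := S.prop_of_epi f (h S hS hX)
  prop_X₂_of_shortExact hS h₁ h₃ S hS' hX :=
    S.prop_X₂_of_shortExact hS (h₁ S hS' hX) (h₃ S hS' hX)

theorem serreClosure_singleton_self (M : C) : serreClosure (ObjectProperty.singleton M) M :=
  fun _ _ h ↦ h _ (by simp)

theorem prop_of_serreClosure {S : ObjectProperty C} (hS : S.IsSerreClass) {M Y : C} (hM : S M)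
    (h : serreClosure (ObjectProperty.singleton M) Y) : S Y :=
  h S hS (by simpa using hM)

theorem sPSupp_subset {S : Set (PSpec C)} {M : C} :
    sPSupp M ⊆ S ↔ ∀ H : Premonoform C,
      serreClosure (ObjectProperty.singleton M) H.1 → PSpec.mk H ∈ S :=
  ⟨fun h H hH ↦ h ⟨H, rfl, hH⟩, by rintro h _ ⟨H, rfl, hH⟩; exact h H hH⟩

theorem sPSupp_mono {M N : C} (h : serreClosure (ObjectProperty.singleton M) N) :
    sPSupp N ⊆ sPSupp M :=
  sPSupp_subset.2 fun H hH ↦ ⟨H, rfl, prop_of_serreClosure inferInstance h hH⟩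

/-- Noetherian objects form a nullity class, so being noetherian does not depend on the
representative. -/
theorem isNoetherianObject_of_mk_mem_nPSpec {H : Premonoform C} (h : PSpec.mk H ∈ nPSpec C) :
    IsNoetherianObject H.1 := by
  obtain ⟨G, hG, _⟩ := h
  have e : nullityClosure G.1 = nullityClosure H.1 := Quotient.exact hG
  have hH : nullityClosure G.1 H.1 := by
    rw [e]; exact fun _ _ h ↦ h
  exact ⟨hH _ ⟨inferInstance, inferInstance⟩ (isNoetherianObject.prop_of_is _)⟩

theorem sPSupp_subset_nPSpec (M : C) [IsNoetherianObject M] : sPSupp M ⊆ nPSpec C :=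
  sPSupp_subset.2 fun H hH ↦ ⟨H, rfl,
    ⟨prop_of_serreClosure inferInstance (isNoetherianObject.prop_of_is M) hH⟩⟩

theorem sPSupp_of_isZero {M : C} (hM : IsZero M) : sPSupp M = ∅ :=
  Set.subset_empty_iff.1 (sPSupp_subset.2 fun H hH ↦
    H.2.1 (prop_of_serreClosure (S := IsZero) inferInstance hM hH))

end SerreClosure

/-! ### Noetherian objects and filtered colimits -/

section Colimits

/-- In a Grothendieck category a morphism from a noetherian object to a filtered colimit factors
through the image of some stage. -/
theorem exists_comp_cokernel_π_eq_zero [IsGrothendieckAbelian.{w} C] {J : Type w}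
    [SemilatticeSup J] [Nonempty J] {D : J ⥤ C} {c : Cocone D} (hc : IsColimit c) {K : C}
    [IsNoetherianObject K] (k : K ⟶ c.pt) : ∃ j, k ≫ cokernel.π (c.ι.app j) = 0 := by
  let q (a b : J) (h : a ≤ b) : cokernel (c.ι.app a) ⟶ cokernel (c.ι.app b) :=
    cokernel.desc _ (cokernel.π (c.ι.app b)) (by
      rw [← c.w (homOfLE h), Category.assoc, cokernel.condition, comp_zero])
  have hq (a b : J) (h : a ≤ b) : cokernel.π (c.ι.app a) ≫ q a b h = cokernel.π (c.ι.app b) :=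
    cokernel.π_desc _ _ _
  -- `N j` is the part of `K` sent into the image of stage `j`. It grows with `j`, so it is constant
  -- beyond a maximal `N j₀`.
  let N (j : J) : Subobject K := kernelSubobject (k ≫ cokernel.π (c.ι.app j))
  obtain ⟨_, ⟨j₀, rfl⟩, hj₀⟩ :=
    (wellFounded_gt (α := Subobject K)).has_min (Set.range N) (Set.range_nonempty N)
  have hN : ∀ j, j₀ ≤ j → N j ≤ N j₀ := by
    intro j hj
    have hle : N j₀ ≤ N j := by
      dsimp only [N]
      rw [← hq j₀ j hj, ← Category.assoc]
      exact kernelSubobject_comp_le _ _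
    by_contra hlt
    exact hj₀ _ ⟨j, rfl⟩ (lt_of_le_not_ge hle hlt)
  refine ⟨j₀, ?_⟩
  -- Joining with `j₀` restricts the system of cokernels to stages beyond `j₀`. Its colimit is zero,
  -- since the stages jointly cover `c.pt`.
  let Q : J ⥤ C :=
    { obj := fun j ↦ cokernel (c.ι.app (j ⊔ j₀))
      map := fun {a b} f ↦ q _ _ (sup_le_sup_right (leOfHom f) j₀)
      map_id := fun a ↦ by
        rw [← cancel_epi (cokernel.π (c.ι.app (a ⊔ j₀))), hq _ _ le_rfl, Category.comp_id]
      map_comp := fun {a b d} f g ↦ by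
        have hab := sup_le_sup_right (leOfHom f) j₀
        have hbd := sup_le_sup_right (leOfHom g) j₀
        rw [← cancel_epi (cokernel.π (c.ι.app (a ⊔ j₀))), hq _ _ (hab.trans hbd),
          ← Category.assoc, hq _ _ hab, hq _ _ hbd] }
  let c' : Cocone Q := ⟨0, { app := fun _ ↦ 0 }⟩
  have hc' : IsColimit c' :=
    { desc := fun _ ↦ 0
      fac := fun s j ↦ by
        have hs : ∀ a b : J, cokernel.π (c.ι.app (a ⊔ j₀)) ≫ s.ι.app a =
            cokernel.π (c.ι.app (b ⊔ j₀)) ≫ s.ι.app b := by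
          have h1 : ∀ (a b : J), a ≤ b → cokernel.π (c.ι.app (a ⊔ j₀)) ≫ s.ι.app a =
              cokernel.π (c.ι.app (b ⊔ j₀)) ≫ s.ι.app b := by
            intro a b hab
            rw [← s.w (homOfLE hab), ← Category.assoc]
            congr 1
            exact (hq _ _ (sup_le_sup_right hab j₀)).symm ▸ rfl
          intro a b
          rw [h1 a (a ⊔ b) le_sup_left, h1 b (a ⊔ b) le_sup_right]
        rw [← cancel_epi (cokernel.π (c.ι.app (j ⊔ j₀)))]
        refine hc.hom_ext fun i ↦ ?_
        rw [hs j i, ← c.w (homOfLE (le_sup_left : i ≤ i ⊔ j₀)), Category.assoc,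
          Category.assoc, cokernel.condition_assoc, zero_comp, comp_zero, comp_zero, comp_zero,
          zero_comp, comp_zero]
      uniq := fun s m _ ↦ (isZero_zero C).eq_of_src _ _ }
  let g : K ⟶ cokernel (c.ι.app j₀) := k ≫ cokernel.π (c.ι.app j₀)
  -- Since `N` is constant beyond `j₀`, `image g` embeds in every cokernel of the system; exactness
  -- of filtered colimits then embeds it in zero.
  let φ : (Functor.const J).obj (image g) ⟶ Q :=
    { app := fun j ↦ image.ι g ≫ q j₀ (j ⊔ j₀) le_sup_right
      naturality := fun a b f ↦ by
        simp only [Functor.const_obj_obj, Functor.const_obj_map, Category.id_comp, Category.assoc]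
        congr 1
        rw [← cancel_epi (cokernel.π (c.ι.app j₀)), hq _ _ le_sup_right, ← Category.assoc,
          hq _ _ le_sup_right]
        exact (hq _ _ (sup_le_sup_right (leOfHom f) j₀)).symm }
  have hφ : ∀ j, Mono (φ.app j) := fun j ↦ by
    refine mono_of_kernelSubobject_comp_le (factorThruImage g) (φ.app j) ?_
    have h1 : factorThruImage g ≫ φ.app j = k ≫ cokernel.π (c.ι.app (j ⊔ j₀)) := by
      simp only [φ, image.fac_assoc, g, Category.assoc, hq]
    have h2 : kernelSubobject (factorThruImage g) = kernelSubobject g := by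
      conv_rhs => rw [← image.fac g]
      exact (kernelSubobject_comp_mono (factorThruImage g) (image.ι g)).symm
    rw [h1, h2]
    exact hN _ le_sup_right
  have : Mono φ := NatTrans.mono_of_mono_app φ
  have : IsConnected J := IsFiltered.isConnected J
  have : Mono (0 : image g ⟶ (0 : C)) := colim.map_mono' φ (isColimitConstCocone J (image g)) hc' 0
    (fun j ↦ (isZero_zero C).eq_of_tgt _ _)
  have hz : image.ι g = 0 := by
    rw [(IsZero.of_mono_eq_zero _ (rfl : (0 : image g ⟶ (0 : C)) = 0)).eq_of_src (image.ι g) 0]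
  exact (image.fac g).symm.trans (by rw [hz, comp_zero])

end Colimits

/-! ### Detection by noetherian subobjects -/

section LocallyNoetherian

theorem prop_sigma_of_finite (S : ObjectProperty C) [S.IsSerreClass] {α : Type*} [Finite α]
    (f : α → C) (h : ∀ a, S (f a)) : S (∐ f) := by
  have : S.IsClosedUnderLimitsOfShape (Discrete.{0} PEmpty) :=
    ⟨fun X hX ↦ S.prop_of_isZero
      (((ObjectProperty.limitsOfShape_isEmpty_iff _ _ X).1 hX).some.isZero)⟩
  have : S.IsClosedUnderBinaryProducts :=
    ⟨fun X ⟨p⟩ ↦ S.prop_of_iso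
      (biprod.isoProd _ _ ≪≫ HasLimit.isoOfNatIso (diagramIsoPair p.diag).symm ≪≫
        (limit.isLimit p.diag).conePointUniqueUpToIso p.isLimit)
      (S.prop_biprod (p.prop_diag_obj ⟨WalkingPair.left⟩) (p.prop_diag_obj ⟨WalkingPair.right⟩))⟩
  have : S.IsClosedUnderFiniteProducts := ObjectProperty.IsClosedUnderFiniteProducts.mk'
  have : HasFiniteBiproducts C := HasFiniteBiproducts.of_hasFiniteProducts
  exact S.prop_of_iso ((biproduct.isoProduct f).symm ≪≫ biproduct.isoCoproduct f)
    (S.prop_product h)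

/-- In a locally noetherian category, every epimorphism onto a noetherian object stays epi on a
suitable noetherian object over its source. -/
theorem exists_isNoetherianObject_epi_comp (hC : IsLocallyNoetherian.{w} C) {Y K : C} (p : Y ⟶ K)
    [Epi p] [IsNoetherianObject K] :
    ∃ (Z : C) (h : Z ⟶ Y), IsNoetherianObject Z ∧ Epi (h ≫ p) := by
  obtain ⟨ι, G, hG, hsep⟩ := hC
  let I : Set (Subobject K) :=
    {N | ∃ (Z : C) (h : Z ⟶ Y), IsNoetherianObject Z ∧ imageSubobject (h ≫ p) = N}
  obtain ⟨_, ⟨Z, h, hZ, rfl⟩, hmax⟩ := (wellFounded_gt (α := Subobject K)).has_min I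
    ⟨_, 0, 0, isNoetherianObject_of_isZero (isZero_zero C), rfl⟩
  refine ⟨Z, h, hZ, Preadditive.epi_of_cancel_zero _ fun {W} u hu ↦ ?_⟩
  rw [← cancel_epi p, comp_zero]
  refine hsep _ _ fun _ hX g ↦ ?_
  obtain ⟨i⟩ := hX
  -- Adding a generator to `Z` cannot enlarge the maximal image, so a map killing that image kills
  -- every `g ≫ p`.
  have hZG : IsNoetherianObject (Z ⊞ G i) :=
    ⟨isNoetherianObject.prop_biprod hZ.prop (hG i).prop⟩
  have hle : imageSubobject (h ≫ p) ≤ imageSubobject (biprod.desc h g ≫ p) := by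
    have : h ≫ p = biprod.inl ≫ biprod.desc h g ≫ p := by simp
    conv_lhs => rw [this]
    exact imageSubobject_comp_le _ _
  have heq : imageSubobject (h ≫ p) = imageSubobject (biprod.desc h g ≫ p) := by
    by_contra hne
    exact hmax _ ⟨_, _, hZG, rfl⟩ (lt_of_le_of_ne hle hne)
  have h0 : (biprod.desc h g ≫ p) ≫ u = 0 := by
    rw [← imageSubobject_arrow_comp (biprod.desc h g ≫ p), Category.assoc,
      ← Subobject.ofLE_arrow heq.ge, Category.assoc, imageSubobject_arrow_comp_eq_zero hu, comp_zero,
      comp_zero]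
  have := biprod.inr ≫= h0
  simpa using this

/-- The objects all of whose noetherian subobjects lie in `S`. -/
def noetherianLocally (S : ObjectProperty C) : ObjectProperty C :=
  fun Y ↦ ∀ (K : C) (k : K ⟶ Y), Mono k → IsNoetherianObject K → S K

/-- Only quotients need local noetherianity: a noetherian subobject `K` of a quotient of `X` is
covered by a noetherian subobject of its preimage in `X`. -/
theorem isSerreClass_noetherianLocally (hC : IsLocallyNoetherian.{w} C) (S : ObjectProperty C)
    [S.IsSerreClass] : (noetherianLocally S).IsSerreClass where
  exists_zero := ⟨0, isZero_zero C, fun _ k _ _ ↦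
    S.prop_of_mono k (S.prop_of_isZero (isZero_zero C))⟩
  prop_of_mono f _ hY K k _ hK := hY K (k ≫ f) (mono_comp _ _) hK
  prop_of_epi {X Y} p _ hX K k _ hK := by
    obtain ⟨Z, h, hZ, _⟩ := exists_isNoetherianObject_epi_comp hC (pullback.snd p k)
    have hI : S (image h) := hX (image h) (image.ι h ≫ pullback.fst p k) (mono_comp _ _)
      (isNoetherianObject_of_epi (factorThruImage h))
    have : Epi (image.ι h ≫ pullback.snd p k) :=
      epi_of_epi_fac (f := factorThruImage h) (h := h ≫ pullback.snd p k) (by simp)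
    exact S.prop_of_epi (image.ι h ≫ pullback.snd p k) hI
  prop_X₂_of_shortExact {T} hT h₁ h₃ K k _ hK := by
    have := hT.mono_f
    refine prop_of_kernel_of_image S (k ≫ T.g) (h₁ _ ?_ ?_ ?_)
      (h₃ _ (image.ι _) inferInstance (isNoetherianObject_of_epi (factorThruImage (k ≫ T.g))))
    · exact hT.exact.lift (kernel.ι (k ≫ T.g) ≫ k) (by simp)
    · exact mono_of_mono_fac (hT.exact.lift_f (kernel.ι (k ≫ T.g) ≫ k) (by simp))
    · exact isNoetherianObject_of_mono (kernel.ι (k ≫ T.g))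

theorem noetherianLocally_of_isColimit [IsGrothendieckAbelian.{w} C] (S : ObjectProperty C)
    [S.IsSerreClass] {J : Type w} {D : Discrete J ⥤ C} {c : Cocone D} (hc : IsColimit c)
    (h : ∀ j, S (D.obj j)) : noetherianLocally S c.pt := by
  classical
  intro K k _ _
  let F := CoproductsFromFiniteFiltered.liftToFinsetObj D
  let e : c.pt ≅ colimit F := hc.coconePointUniqueUpToIso
    (CoproductsFromFiniteFiltered.liftToFinsetColimitCocone D).isColimit
  obtain ⟨s, hs⟩ := exists_comp_cokernel_π_eq_zero.{w} (colimit.isColimit F) (k ≫ e.hom)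
  have hF : S (F.obj s) := prop_sigma_of_finite S _ fun x ↦ h x.1
  have hI : S (Abelian.image (colimit.ι F s)) :=
    S.prop_of_epi (Abelian.factorThruImage (colimit.ι F s)) hF
  have : Mono (kernel.lift (cokernel.π (colimit.ι F s)) (k ≫ e.hom) hs) :=
    mono_of_mono_fac (kernel.lift_ι _ _ _)
  exact S.prop_of_mono (kernel.lift (cokernel.π (colimit.ι F s)) (k ≫ e.hom) hs) hI

/-- A localizing subcategory of a locally noetherian category contains an object as soon as it
contains its noetherian subobjects. -/
theorem prop_of_noetherianLocally [IsGrothendieckAbelian.{w} C] (hC : IsLocallyNoetherian.{w} C)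
    {X : ObjectProperty C} (hX : IsLocalizing.{w} X) {M : C} (hM : noetherianLocally X M) :
    X M := by
  obtain ⟨ι, G, hG, hsep⟩ := hC
  obtain ⟨_, hcop⟩ := hX
  -- All morphisms from generators to `M`, shrunk so that the coproduct is indexed in `Type w`;
  -- their images jointly cover `M`.
  let J : Type w := Σ i, Shrink.{w} (G i ⟶ M)
  let g (j : J) : G j.1 ⟶ M := (equivShrink _).symm j.2
  have : X.IsClosedUnderColimitsOfShape (Discrete J) := hcop J
  have h : X (∐ fun j ↦ image (g j)) := X.prop_colimit _ fun j ↦ by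
    have := hG j.as.1
    exact hM _ (image.ι (g j.as)) inferInstance (isNoetherianObject_of_epi (factorThruImage _))
  have : Epi (Sigma.desc fun j ↦ image.ι (g j)) := ⟨fun a b hab ↦ by
    refine hsep _ _ fun _ hY f ↦ ?_
    obtain ⟨i⟩ := hY
    have hj := Sigma.ι (fun j ↦ image (g j)) ⟨i, equivShrink _ f⟩ ≫= hab
    simp only [Sigma.ι_desc_assoc] at hj
    have hf : g ⟨i, equivShrink _ f⟩ = f := by simp [g]
    rw [← hf, ← image.fac (g ⟨i, equivShrink _ f⟩), Category.assoc, Category.assoc, hj]⟩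
  exact X.prop_of_epi (Sigma.desc fun j ↦ image.ι (g j)) h

end LocallyNoetherian

/-! ### The correspondence -/

section Main

variable [IsGrothendieckAbelian.{w} C]

theorem nsPSuppInv_nsPSuppOf (hC : IsLocallyNoetherian.{w} C) {X : ObjectProperty C}
    (hX : IsLocalizing.{w} X) : nsPSuppInv (nsPSuppOf X) = X := by
  have := hX.1
  ext M
  refine ⟨fun hM ↦ prop_of_noetherianLocally hC hX fun K k _ hK ↦ ?_, fun hM p hp ↦
    ⟨Set.mem_biUnion hM hp.1, hp.2⟩⟩
  refine prop_of_premonoform_quotients X K fun Q π _ hQ ↦ ?_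
  have hKM : serreClosure (ObjectProperty.singleton M) K :=
    ObjectProperty.prop_of_mono _ k (serreClosure_singleton_self M)
  have hQM : serreClosure (ObjectProperty.singleton M) Q := ObjectProperty.prop_of_epi _ π hKM
  have hmem : PSpec.mk ⟨Q, hQ⟩ ∈ nsPSupp M :=
    ⟨⟨_, rfl, hQM⟩, ⟨_, rfl, isNoetherianObject_of_epi π⟩⟩
  obtain ⟨N, hN, hQN⟩ := Set.mem_iUnion₂.1 (hM hmem).1
  exact prop_of_serreClosure this hN ((mk_mem_sPSupp_iff ⟨Q, hQ⟩ N).1 hQN)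

omit [IsGrothendieckAbelian.{w} C] in
theorem nsPSuppOf_nsPSuppInv {Φ : Set (PSpec C)} (hΦ : Φ ⊆ nPSpec C) (hS : IsSerreClosed Φ) :
    nsPSuppOf (nsPSuppInv Φ) = Φ := by
  refine Set.Subset.antisymm ?_ fun p hp ↦ ?_
  · rintro p ⟨hp, hpn⟩
    obtain ⟨M, hM, hpM⟩ := Set.mem_iUnion₂.1 hp
    exact hM ⟨hpM, hpn⟩
  · obtain ⟨H, rfl⟩ := Quotient.exists_rep p
    exact ⟨Set.mem_biUnion (x := H.1) (fun q hq ↦ hS H hp hq.1)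
      ⟨H, rfl, serreClosure_singleton_self H.1⟩, hΦ hp⟩

omit [IsGrothendieckAbelian.{w} C] in
-- As `H` is noetherian, so is every object of `√H`; hence all of `sPSupp H` stays in `nPSpec C`.
theorem isSerreClosed_nsPSuppOf (X : ObjectProperty C) : IsSerreClosed (nsPSuppOf X) := by
  rintro H ⟨hH, hHn⟩
  have := isNoetherianObject_of_mk_mem_nPSpec hHn
  obtain ⟨M, hM, hHM⟩ := Set.mem_iUnion₂.1 hH
  exact fun p hp ↦ ⟨Set.mem_biUnion hM (sPSupp_mono ((mk_mem_sPSupp_iff H M).1 hHM) hp),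
    sPSupp_subset_nPSpec H.1 hp⟩

theorem isSerreExtensionClosed_nsPSuppOf (hC : IsLocallyNoetherian.{w} C) {X : ObjectProperty C}
    (hX : IsLocalizing.{w} X) : IsSerreExtensionClosed (nsPSuppOf X) := by
  intro S hS h₁ h₃
  have := hX.1
  have h := nsPSuppInv_nsPSuppOf hC hX
  change nsPSuppInv (nsPSuppOf X) S.X₁ at h₁
  change nsPSuppInv (nsPSuppOf X) S.X₃ at h₃
  change nsPSuppInv (nsPSuppOf X) S.X₂
  rw [h] at *
  exact X.prop_X₂_of_shortExact hS h₁ h₃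

omit [IsGrothendieckAbelian.{w} C] in
theorem isSerreClass_nsPSuppInv {Φ : Set (PSpec C)} (hE : IsSerreExtensionClosed Φ) :
    (nsPSuppInv Φ).IsSerreClass where
  exists_zero := ⟨0, isZero_zero C, by
    rintro p ⟨hp, -⟩
    rw [sPSupp_of_isZero (isZero_zero C)] at hp
    exact hp.elim⟩
  prop_of_mono f _ h p hp := h ⟨sPSupp_mono
    (ObjectProperty.prop_of_mono _ f (serreClosure_singleton_self _)) hp.1, hp.2⟩
  prop_of_epi f _ h p hp := h ⟨sPSupp_mono
    (ObjectProperty.prop_of_epi _ f (serreClosure_singleton_self _)) hp.1, hp.2⟩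
  prop_X₂_of_shortExact hS h₁ h₃ := hE _ hS h₁ h₃

theorem isLocalizing_nsPSuppInv (hC : IsLocallyNoetherian.{w} C) {Φ : Set (PSpec C)}
    (hE : IsSerreExtensionClosed Φ) : IsLocalizing.{w} (nsPSuppInv Φ) := by
  have hΦ := isSerreClass_nsPSuppInv hE
  refine ⟨hΦ, fun J ↦ ⟨fun M ⟨p⟩ ↦ ?_⟩⟩
  rintro _ ⟨⟨H, rfl, hH⟩, hHn⟩
  have hL := noetherianLocally_of_isColimit.{w} (nsPSuppInv Φ) p.isColimit p.prop_diag_obj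
  -- `H` need not be a subobject of the coproduct, only lie in its Serre closure; this is why
  -- `noetherianLocally` has to be a Serre class.
  have hHL := prop_of_serreClosure (isSerreClass_noetherianLocally hC _) hL hH
  exact hHL H.1 (𝟙 _) inferInstance (isNoetherianObject_of_mk_mem_nPSpec hHn)
    ⟨⟨H, rfl, serreClosure_singleton_self _⟩, hHn⟩

end Main

end PremonoformSpectrum

theorem mainTheorem4 {C : Type u} [Category.{v} C] [Abelian C] [IsGrothendieckAbelian.{w} C]
    (hC : PremonoformSpectrum.IsLocallyNoetherian.{w} C) :
    Set.BijOn (PremonoformSpectrum.nsPSuppOf (C := C))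
      {X : ObjectProperty C | PremonoformSpectrum.IsLocalizing.{w} X}
      {Φ : Set (PremonoformSpectrum.PSpec C) | Φ ⊆ PremonoformSpectrum.nPSpec C ∧
        PremonoformSpectrum.IsSerreClosed Φ ∧ PremonoformSpectrum.IsSerreExtensionClosed Φ} ∧
    Set.BijOn (PremonoformSpectrum.nsPSuppInv (C := C))
      {Φ : Set (PremonoformSpectrum.PSpec C) | Φ ⊆ PremonoformSpectrum.nPSpec C ∧
        PremonoformSpectrum.IsSerreClosed Φ ∧ PremonoformSpectrum.IsSerreExtensionClosed Φ}
      {X : ObjectProperty C | PremonoformSpectrum.IsLocalizing.{w} X} ∧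
    Set.InvOn (PremonoformSpectrum.nsPSuppInv (C := C)) (PremonoformSpectrum.nsPSuppOf (C := C))
      {X : ObjectProperty C | PremonoformSpectrum.IsLocalizing.{w} X}
      {Φ : Set (PremonoformSpectrum.PSpec C) | Φ ⊆ PremonoformSpectrum.nPSpec C ∧
        PremonoformSpectrum.IsSerreClosed Φ ∧ PremonoformSpectrum.IsSerreExtensionClosed Φ} := by
  have hInv : Set.InvOn (PremonoformSpectrum.nsPSuppInv (C := C))
      (PremonoformSpectrum.nsPSuppOf (C := C))
      {X : ObjectProperty C | PremonoformSpectrum.IsLocalizing.{w} X}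
      {Φ : Set (PremonoformSpectrum.PSpec C) | Φ ⊆ PremonoformSpectrum.nPSpec C ∧
        PremonoformSpectrum.IsSerreClosed Φ ∧ PremonoformSpectrum.IsSerreExtensionClosed Φ} :=
    ⟨fun _ hX ↦ PremonoformSpectrum.nsPSuppInv_nsPSuppOf hC hX,
      fun _ hΦ ↦ PremonoformSpectrum.nsPSuppOf_nsPSuppInv hΦ.1 hΦ.2.1⟩
  have h₁ : Set.MapsTo (PremonoformSpectrum.nsPSuppOf (C := C))
      {X : ObjectProperty C | PremonoformSpectrum.IsLocalizing.{w} X}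
      {Φ : Set (PremonoformSpectrum.PSpec C) | Φ ⊆ PremonoformSpectrum.nPSpec C ∧
        PremonoformSpectrum.IsSerreClosed Φ ∧ PremonoformSpectrum.IsSerreExtensionClosed Φ} :=
    fun X hX ↦ ⟨Set.inter_subset_right, PremonoformSpectrum.isSerreClosed_nsPSuppOf X,
      PremonoformSpectrum.isSerreExtensionClosed_nsPSuppOf hC hX⟩
  have h₂ : Set.MapsTo (PremonoformSpectrum.nsPSuppInv (C := C))
      {Φ : Set (PremonoformSpectrum.PSpec C) | Φ ⊆ PremonoformSpectrum.nPSpec C ∧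
        PremonoformSpectrum.IsSerreClosed Φ ∧ PremonoformSpectrum.IsSerreExtensionClosed Φ}
      {X : ObjectProperty C | PremonoformSpectrum.IsLocalizing.{w} X} :=
    fun _ hΦ ↦ PremonoformSpectrum.isLocalizing_nsPSuppInv hC hΦ.2.2
  exact ⟨hInv.bijOn h₁ h₂, hInv.symm.bijOn h₂ h₁, hInv⟩
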